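/- Let $L:[0,\infty)\to[0,\infty)$ be a physically feasible path loss function, i.e. $L(r)\le L(0)<\infty$ for all $r\ge 0$ and $\gamma:=\int_0^\infty rL(r)\,dr\in(0,\infty)$. On one probability space, for $\lambda>0$ let $\Phi_\lambda$ be a homogeneous Poisson point process in $\mathbb{R}^2$ with intensity $\lambda$, the family being coupled by superposition: the points that are added when the intensity is raised from $a$ to $b$ ($0\le a<b$, with $\Phi_0=\emptyset$) form a homogeneous Poisson point process with intensity $b-a$, and the point processes added over disjoint ranges of intensity are independent. Enumerate all the points that ever occur as $x_0,x_1,\dots$, let $x_i$ carry a real mark $g_i$, where $g_0,g_1,\dots$ are i.i.d. with $\mathbb{E}[g_i]=1$ and the sequence $(g_i)$ is independent of the points and of the intensity levels at which they are added, and put $r_i=\|x_i\|$. For $n\in\{0,1,2,\dots\}$ let $R_n(\lambda)$ be the distance from the origin to the $(n+1)$-th closest point of $\Phi_\lambda$. Then, for every fixed $n$, almost surely the sum $$S_n(\lambda)=\sum_{i:\;x_i\in\Phi_\lambda\setminus B(0,R_n(\lambda))}L(r_i)\,g_i$$ converges absolutely for all $\lambda>0$, and $$\lim_{\lambda\to\infty}\frac1\lambda\,S_n(\lambda)=2\pi\gamma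 ,$$ where $\lambda$ runs through the positive reals. This holds both when $B(0,R)$ is the open and when it is the closed disk of radius $R$ centred at the origin. -/

import Mathlib

open MeasureTheory ProbabilityTheory Filter Topology Set
open scoped ENNReal NNReal

noncomputable section

/-- The Euclidean plane, carrying the Euclidean norm and Lebesgue measure. -/
abbrev Plane : Type := EuclideanSpace ℝ (Fin 2)

/-- `γ = ∫₀^∞ r L(r) dr`. -/
def pathGamma (L : ℝ → ℝ) : ℝ := ∫ r in Ioi (0 : ℝ), r * L r

/-- Physically feasible path loss: `L : [0,∞) → [0,∞)` is bounded by its (finite) value at `0`, and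
`γ = ∫₀^∞ r L(r) dr` is finite and positive. Only the values of `L` on `[0,∞)` matter. -/
structure PhysicallyFeasible (L : ℝ → ℝ) : Prop where
  nonneg : ∀ r, 0 ≤ r → 0 ≤ L r
  le_zero : ∀ r, 0 ≤ r → L r ≤ L 0
  integrable : IntegrableOn (fun r => r * L r) (Ioi (0 : ℝ)) volume
  gamma_pos : 0 < pathGamma L

/-- A random counting function `N` on the measurable subsets of `E` is that of a Poisson point
process with intensity measure `μ`: the number of points in a set of finite intensity is Poisson
distributed with that mean, and the numbers of points in disjoint sets are independent. -/
structure IsPoissonPointProcess {Ω E : Type*} [MeasurableSpace Ω] [MeasurableSpace E]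
    (N : Set E → Ω → ℕ∞) (μ : Measure E) (P : Measure Ω) : Prop where
  law : ∀ B : Set E, MeasurableSet B → μ B ≠ ∞ →
    HasLaw (N B) ((poissonMeasure (μ B).toNNReal).map (fun k : ℕ => (k : ℕ∞))) P
  indep : ∀ (m : ℕ) (B : Fin m → Set E), (∀ j, MeasurableSet (B j)) →
    Pairwise (fun j k => Disjoint (B j) (B k)) → iIndepFun (fun j => N (B j)) P

/-- Number of points `x i` in `B` whose level `s i` lies in `(a, b]`. -/
def countIn {Ω : Type*} (x : ℕ → Ω → Plane) (s : ℕ → Ω → ℝ) (a b : ℝ) (B : Set Plane) (ω : Ω) :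
    ℕ∞ :=
  {i : ℕ | s i ω ∈ Ioc a b ∧ x i ω ∈ B}.encard

/-- A family `(Φ_λ)` of homogeneous Poisson point processes of intensity `λ`, for `λ > 0`, all on
one probability space and coupled by superposition. The points ever used are `x 0, x 1, …`, and the
point `x i` is added at level `s i`: the points of `Φ_λ` are the `x i` with `0 < s i ≤ λ`.
Raising the intensity from `a` to `b` superposes a homogeneous Poisson point process of
intensity `b - a` (for `a = 0`: this is `Φ_b` itself), and the processes superposed over
successive ranges of intensity are independent. -/
structure IsSuperposedHPPP {Ω : Type*} [MeasurableSpace Ω] (x : ℕ → Ω → Plane) (s : ℕ → Ω → ℝ)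
    (P : Measure Ω) : Prop where
  measurable_point : ∀ i, Measurable (x i)
  measurable_level : ∀ i, Measurable (s i)
  poisson : ∀ a b : ℝ, 0 ≤ a → a < b →
    IsPoissonPointProcess (countIn x s a b) (ENNReal.ofReal (b - a) • (volume : Measure Plane)) P
  indep : ∀ t : ℕ → ℝ, 0 ≤ t 0 → StrictMono t →
    iIndepFun (fun (j : ℕ) (ω : Ω) (B : {B : Set Plane // MeasurableSet B}) =>
      countIn x s (t j) (t (j + 1)) B.1 ω) P

/-- The distance `r_n` from the origin to the `n`-th closest point of `Φ_λ`, counted from `n = 0`,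
so that `r_0` is the distance to the closest point: the least `r` such that at least `n + 1` points
of `Φ_λ` are within distance `r` of the origin. -/
def nthDist {Ω : Type*} (x : ℕ → Ω → Plane) (s : ℕ → Ω → ℝ) (n : ℕ) (lam : ℝ) (ω : Ω) : ℝ :=
  sInf {r : ℝ | ((n + 1 : ℕ) : ℕ∞) ≤ countIn x s 0 lam (Metric.closedBall 0 r) ω}

/-- The contribution `L(r_i) g_i` of the `i`-th point to the sum over `Φ_λ \ B`, being `0` if that
point is not in `Φ_λ \ B`. -/
def outsideTerm {Ω : Type*} (L : ℝ → ℝ) (x : ℕ → Ω → Plane) (s : ℕ → Ω → ℝ) (g : ℕ → Ω → ℝ)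
    (lam : ℝ) (B : Set Plane) (ω : Ω) : ℕ → ℝ :=
  {i : ℕ | s i ω ∈ Ioc 0 lam ∧ x i ω ∉ B}.indicator (fun i => L ‖x i ω‖ * g i ω)

end

/-! Cut the range of intensities into the slabs `(k, k+1]`. The sums of `f (x i) * g i` over the
points added in different slabs are pairwise independent and identically distributed, with mean `(∫
f) * E[g]`, so for nonnegative marks the strong law gives the limit along integer intensities, and
monotonicity in the intensity extends it to real ones (`ae_tendsto_markSum_div`). Real marks are
split into positive and negative parts. With `f p = L ‖p‖`, polar coordinates turn `∫ f` into `2πγ`.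

Removing the nearest points costs nothing in the limit. The number of points in any fixed disk grows
linearly, so `R_n(λ)` is eventually below every `r > 0`. The removed part is then at most the sum
with marks `|g i|` over the disk of radius `r`, which by the same strong law is asymptotic to `λ
E|g| ∫_{‖p‖ ≤ r} f`, and that integral vanishes as `r → 0`.

Independence of the slab sums comes from characteristic functions. For a step function `f`, freezing
the points and integrating out the marks leaves a product of powers `φ(c)^N`, with `N` the number of
points in a cell; independence of the Poisson counts factorizes its expectation
(`exists_integral_exp_markSum_step`). Monotone approximation by simple functions reaches general
`f`. -/

/-! ### Characteristic functions of sums of marks at random points -/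

theorem ProbabilityTheory.IndepFun.integral_comp_prodMk {Ω α β : Type*} [MeasurableSpace Ω]
    [MeasurableSpace α] [MeasurableSpace β] {P : Measure Ω} [IsProbabilityMeasure P]
    {X : Ω → α} {Y : Ω → β} (hX : Measurable X) (hY : Measurable Y) (h : IndepFun X Y P)
    {F : α × β → ℂ} (hF : Measurable F) {C : ℝ} (hC : ∀ p, ‖F p‖ ≤ C) :
    ∫ ω, F (X ω, Y ω) ∂P = ∫ ω, ∫ ω', F (X ω', Y ω) ∂P ∂P := by
  have h1 := (indepFun_iff_map_prod_eq_prod_map_map hX.aemeasurable hY.aemeasurable).1 h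
  have := Measure.isProbabilityMeasure_map (μ := P) hX.aemeasurable
  have := Measure.isProbabilityMeasure_map (μ := P) hY.aemeasurable
  have hint : Integrable F ((P.map X).prod (P.map Y)) :=
    Integrable.of_bound hF.aestronglyMeasurable C (ae_of_all _ hC)
  have h2 : ∫ ω, F (X ω, Y ω) ∂P = ∫ p, F p ∂(P.map (fun ω => (X ω, Y ω))) :=
    (integral_map (hX.prodMk hY).aemeasurable hF.aestronglyMeasurable).symm
  rw [h2, h1, integral_prod_symm _ hint, integral_map hY.aemeasurable
    hint.integral_prod_right.aestronglyMeasurable]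
  refine integral_congr_ae (ae_of_all _ fun ω => ?_)
  exact integral_map hX.aemeasurable (hF.comp (measurable_id.prodMk measurable_const)).aestronglyMeasurable

theorem eventually_prod_range_ite_eq_pow_ncard {M : Type*} [CommMonoid M] {S : Set ℕ}
    [DecidablePred (· ∈ S)] (hS : S.Finite) (a : M) :
    ∀ᶠ m in atTop, ∏ i ∈ Finset.range m, (if i ∈ S then a else 1) = a ^ S.ncard := by
  obtain ⟨b, hb⟩ := hS.bddAbove
  filter_upwards [eventually_gt_atTop b] with m hm
  rw [Finset.prod_ite, Finset.prod_const_one, mul_one, Finset.prod_const,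
    ← Set.ncard_coe_finset]
  congr 2
  ext i
  simp only [Finset.coe_filter, Finset.mem_range, mem_ofPred_eq, and_iff_right_iff_imp]
  exact fun hi => (hb hi).trans_lt hm

section Marks

variable {Ω E : Type*} [MeasurableSpace Ω] [MeasurableSpace E] {P : Measure Ω}
  [IsProbabilityMeasure P] {z : ℕ → Ω → E} {G : ℕ → Ω → ℝ}

/-- By Fubini the points can be frozen while the marks are integrated out; for frozen points the
exponential is a product of functions of independent marks. -/
theorem integral_exp_sum_range_marks (hz : ∀ i, Measurable (z i)) (hG : ∀ i, Measurable (G i))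
    (hGi : iIndepFun G P) (hGd : ∀ i, IdentDistrib (G i) (G 0) P P)
    (hGz : IndepFun (fun ω i => G i ω) (fun ω i => z i ω) P)
    {w : E → ℝ} (hw : Measurable w) (m : ℕ) :
    ∫ ω, Complex.exp ((∑ i ∈ Finset.range m, w (z i ω) * G i ω : ℝ) * Complex.I) ∂P =
      ∫ ω, ∏ i ∈ Finset.range m, charFun (P.map (G 0)) (w (z i ω)) ∂P := by
  have hF : Measurable (fun p : (ℕ → ℝ) × (ℕ → E) =>
      Complex.exp ((∑ i ∈ Finset.range m, w (p.2 i) * p.1 i : ℝ) * Complex.I)) := by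
    fun_prop
  rw [ProbabilityTheory.IndepFun.integral_comp_prodMk (measurable_pi_lambda _ hG)
    (measurable_pi_lambda _ hz) hGz hF (C := 1)
    (fun p => (Complex.norm_exp_ofReal_mul_I _).le)]
  refine integral_congr_ae (ae_of_all _ fun ω => ?_)
  have hprod : ∀ ω', Complex.exp ((∑ i ∈ Finset.range m, w (z i ω) * G i ω' : ℝ) * Complex.I)
      = ∏ i : Fin m, Complex.exp ((w (z i ω) * G i ω' : ℝ) * Complex.I) := by
    intro ω'
    rw [Fin.prod_univ_eq_prod_range
      (fun i => Complex.exp ((w (z i ω) * G i ω' : ℝ) * Complex.I)) m, ← Complex.exp_sum]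
    push_cast
    rw [Finset.sum_mul]
  simp only [hprod]
  have hind : iIndepFun (fun i : Fin m => G i) P := hGi.precomp Fin.val_injective
  rw [hind.integral_fun_prod_comp (fun i => (hG i).aemeasurable)
    (f := fun (i : Fin m) y => Complex.exp ((w (z i ω) * y : ℝ) * Complex.I))
    (fun i => by fun_prop), Fin.prod_univ_eq_prod_range
    (fun i => ∫ ω', Complex.exp ((w (z i ω) * G i ω' : ℝ) * Complex.I) ∂P) m]
  refine Finset.prod_congr rfl fun i _ => ?_
  rw [← (hGd i).map_eq, charFun_apply_real, integral_map (hG i).aemeasurable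
    (by fun_prop)]
  simp

/-- The characteristic function of a finite sum of independent identically distributed marks,
weighted according to the cell of a finite family of disjoint sets into which a point falls. -/
theorem integral_exp_tsum_marks {ι : Type*} [Fintype ι] {C : ι → Set E}
    (hC : ∀ a, MeasurableSet (C a)) (hCd : Pairwise fun a b => Disjoint (C a) (C b))
    (hz : ∀ i, Measurable (z i)) (hG : ∀ i, Measurable (G i))
    (hGi : iIndepFun G P) (hGd : ∀ i, IdentDistrib (G i) (G 0) P P)
    (hGz : IndepFun (fun ω i => G i ω) (fun ω i => z i ω) P)
    (hfin : ∀ᵐ ω ∂P, ∀ a, {i | z i ω ∈ C a}.Finite) (c : ι → ℝ) :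
    ∫ ω, Complex.exp ((∑' i, (∑ a, (C a).indicator (fun _ => c a) (z i ω)) * G i ω : ℝ)
        * Complex.I) ∂P =
      ∫ ω, ∏ a, charFun (P.map (G 0)) (c a) ^ {i | z i ω ∈ C a}.ncard ∂P := by
  classical
  have := Measure.isProbabilityMeasure_map (μ := P) (hG 0).aemeasurable
  set w : E → ℝ := fun p => ∑ a, (C a).indicator (fun _ => c a) p with hwdef
  have hw : Measurable w :=
    Finset.measurable_sum _ fun a _ => measurable_const.indicator (hC a)
  set φ := charFun (P.map (G 0)) with hφ
  -- By disjointness at most one factor differs from `1`; off all the cells `w p = 0` and `φ 0 = 1`.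
  have hφw : ∀ p, φ (w p) = ∏ a, if p ∈ C a then φ (c a) else 1 := by
    intro p
    by_cases hp : ∃ a, p ∈ C a
    · obtain ⟨a, ha⟩ := hp
      have hne : ∀ b, b ≠ a → p ∉ C b := fun b hb hpb =>
        (Set.disjoint_left.1 (hCd hb) hpb) ha
      have h1 : w p = c a := by
        rw [hwdef]
        simp only
        rw [Finset.sum_eq_single a]
        · simp [ha]
        · intro b _ hb; simp [hne b hb]
        · simp
      rw [h1, Finset.prod_eq_single a]
      · simp [ha]
      · intro b _ hb; simp [hne b hb]
      · simp
    · push Not at hp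
      have h1 : w p = 0 := Finset.sum_eq_zero fun a _ => by simp [hp a]
      rw [h1, hφ, charFun_zero]
      simp [hp]
  -- Almost surely only finitely many points lie in the cells, so the truncated sums and products
  -- are eventually constant; every integrand has norm at most `1`.
  have hleft : Tendsto (fun m => ∫ ω, Complex.exp
      ((∑ i ∈ Finset.range m, w (z i ω) * G i ω : ℝ) * Complex.I) ∂P) atTop
      (𝓝 (∫ ω, Complex.exp ((∑' i, w (z i ω) * G i ω : ℝ) * Complex.I) ∂P)) := by
    refine tendsto_integral_of_dominated_convergence (fun _ => 1) (fun m => ?_)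
      (integrable_const _) (fun m => ae_of_all _ fun ω => (Complex.norm_exp_ofReal_mul_I _).le) ?_
    · refine Measurable.aestronglyMeasurable ?_
      have : ∀ i, Measurable fun ω => w (z i ω) := fun i => hw.comp (hz i)
      fun_prop
    · filter_upwards [hfin] with ω hω
      have hsum : Summable fun i => w (z i ω) * G i ω := by
        refine summable_of_hasFiniteSupport ((Set.finite_iUnion hω).subset ?_)
        intro i hi
        by_contra hcon
        simp only [mem_iUnion, mem_ofPred_eq, not_exists] at hcon
        apply hi
        simp [hwdef, hcon]
      have h2 := hsum.hasSum.tendsto_sum_nat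
      exact (Complex.continuous_exp.tendsto _).comp
        (((Complex.continuous_ofReal.tendsto _).comp h2).mul_const _)
  have hright : Tendsto (fun m => ∫ ω, ∏ i ∈ Finset.range m, φ (w (z i ω)) ∂P) atTop
      (𝓝 (∫ ω, ∏ a, φ (c a) ^ {i | z i ω ∈ C a}.ncard ∂P)) := by
    refine tendsto_integral_of_dominated_convergence (fun _ => 1) (fun m => ?_)
      (integrable_const _) (fun m => ae_of_all _ fun ω => ?_) ?_
    · refine Measurable.aestronglyMeasurable ?_
      have : ∀ i, Measurable fun ω => φ (w (z i ω)) := fun i =>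
        measurable_charFun.comp (hw.comp (hz i))
      fun_prop
    · rw [norm_prod]
      exact Finset.prod_le_one (fun _ _ => norm_nonneg _) fun _ _ => norm_charFun_le_one _
    · filter_upwards [hfin] with ω hω
      refine tendsto_const_nhds.congr' ?_
      have := eventually_all.2 fun a => eventually_prod_range_ite_eq_pow_ncard (hω a) (φ (c a))
      filter_upwards [this] with m hm
      simp only [hφw]
      rw [Finset.prod_comm]
      exact (Finset.prod_congr rfl fun a _ => hm a).symm
  refine tendsto_nhds_unique hleft (hright.congr fun m => ?_)
  exact (integral_exp_sum_range_marks hz hG hGi hGd hGz hw m).symm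

end Marks

/-! ### Means and independence of Poisson counts -/

theorem lintegral_natCast_poissonMeasure (r : ℝ≥0) :
    ∫⁻ n : ℕ, (n : ℝ≥0∞) ∂(poissonMeasure r) = r := by
  have h0 := (hasSum_one_poissonMeasure r).mul_left (r : ℝ)
  rw [mul_one] at h0
  have h1 : HasSum (fun n : ℕ => Real.exp (-r) * r ^ n / n.factorial * (n : ℝ)) r := by
    rw [← hasSum_nat_add_iff' 1]
    simp only [Finset.range_one, Finset.sum_singleton, Nat.cast_zero, mul_zero, sub_zero]
    convert! h0 using 1
    funext n
    rw [Nat.factorial_succ]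
    push_cast
    field_simp
    ring
  have h2 : ∀ n : ℕ, 0 ≤ Real.exp (-r) * r ^ n / n.factorial * (n : ℝ) := fun n => by positivity
  rw [poissonMeasure, lintegral_sum_measure]
  simp only [lintegral_smul_measure, lintegral_dirac, smul_eq_mul]
  calc ∑' n : ℕ, ENNReal.ofReal (Real.exp (-r) * r ^ n / n.factorial) * (n : ℝ≥0∞)
      = ∑' n : ℕ, ENNReal.ofReal (Real.exp (-r) * r ^ n / n.factorial * (n : ℝ)) := by
        refine tsum_congr fun n => ?_
        rw [ENNReal.ofReal_mul (by positivity), ENNReal.ofReal_natCast]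
    _ = r := by
        rw [← ENNReal.ofReal_tsum_of_nonneg h2 h1.summable, h1.tsum_eq, ENNReal.ofReal_coe_nnreal]

section PointProcess

variable {Ω : Type*} [MeasurableSpace Ω] {P : Measure Ω} {x : ℕ → Ω → Plane} {s : ℕ → Ω → ℝ}

theorem IsPoissonPointProcess.ae_ne_top {E : Type*} [MeasurableSpace E] {N : Set E → Ω → ℕ∞}
    {μ : Measure E} (hN : IsPoissonPointProcess N μ P) {B : Set E} (hB : MeasurableSet B)
    (hμ : μ B ≠ ∞) : ∀ᵐ ω ∂P, N B ω ≠ ⊤ := by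
  have hl := hN.law B hB hμ
  rw [hl.ae_iff (p := fun k => k ≠ ⊤) (measurable_of_countable _),
    ae_map_iff .of_discrete .of_discrete]
  exact ae_of_all _ fun k => ENat.natCast_ne_top k

theorem IsPoissonPointProcess.lintegral_eq {E : Type*} [MeasurableSpace E]
    {N : Set E → Ω → ℕ∞} {μ : Measure E} (hN : IsPoissonPointProcess N μ P) {B : Set E}
    (hB : MeasurableSet B) (hμ : μ B ≠ ∞) :
    ∫⁻ ω, (N B ω : ℝ≥0∞) ∂P = μ B := by
  rw [(hN.law B hB hμ).lintegral_comp (f := fun k : ℕ∞ => (k : ℝ≥0∞)) (by fun_prop),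
    lintegral_map .of_discrete .of_discrete]
  simp only [ENat.toENNReal_coe]
  rw [lintegral_natCast_poissonMeasure, ENNReal.coe_toNNReal hμ]

theorem IsPoissonPointProcess.iIndepFun_of_fintype {E ι : Type*} [MeasurableSpace E] [Fintype ι]
    {N : Set E → Ω → ℕ∞} {μ : Measure E} (hN : IsPoissonPointProcess N μ P) {B : ι → Set E}
    (hB : ∀ q, MeasurableSet (B q)) (hBd : Pairwise fun a b => Disjoint (B a) (B b)) :
    iIndepFun (fun q => N (B q)) P := by
  have h := hN.indep (Fintype.card ι) (fun j => B ((Fintype.equivFin ι).symm j))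
    (fun j => hB _) (fun j k hjk => hBd ((Fintype.equivFin ι).symm.injective.ne hjk))
  exact h.of_precomp (g := (Fintype.equivFin ι).symm) (Fintype.equivFin ι).symm.surjective

theorem IsSuperposedHPPP.intensity_ne_top {B : Set Plane} (hB : volume B ≠ ∞) (r : ℝ) :
    (ENNReal.ofReal r • (volume : Measure Plane)) B ≠ ∞ := by
  simpa using ENNReal.mul_ne_top ENNReal.ofReal_ne_top hB

theorem IsSuperposedHPPP.ae_finite (hΦ : IsSuperposedHPPP x s P) {a b : ℝ} (ha : 0 ≤ a)
    (hab : a < b) {B : Set Plane} (hB : MeasurableSet B) (hv : volume B ≠ ∞) :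
    ∀ᵐ ω ∂P, {i | s i ω ∈ Ioc a b ∧ x i ω ∈ B}.Finite := by
  filter_upwards [(hΦ.poisson a b ha hab).ae_ne_top hB (intensity_ne_top hv _)] with ω hω
  exact encard_ne_top_iff.1 hω

/-- The expected sum of a function over the points added between two levels. -/
theorem IsSuperposedHPPP.lintegral_tsum (hΦ : IsSuperposedHPPP x s P) {a b : ℝ} (ha : 0 ≤ a)
    (hab : a < b) {f : Plane → ℝ≥0∞} (hf : Measurable f) :
    ∑' i, ∫⁻ ω, {ω | s i ω ∈ Ioc a b}.indicator (fun ω => f (x i ω)) ω ∂P =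
      ENNReal.ofReal (b - a) * ∫⁻ p, f p := by
  have hs : ∀ i, MeasurableSet {ω | s i ω ∈ Ioc a b} := fun i =>
    hΦ.measurable_level i measurableSet_Ioc
  have key : Measure.sum (fun i => (P.restrict {ω | s i ω ∈ Ioc a b}).map (x i)) =
      ENNReal.ofReal (b - a) • (volume : Measure Plane) := by
    -- The law of a count is prescribed only for sets of finite intensity, so the two measures are
    -- compared on each set of an exhaustion by finite volume.
    refine (Measure.ext_iff_of_iUnion_eq_univ (iUnion_spanningSets
      (volume : Measure Plane))).2 fun m => Measure.ext fun B hB => ?_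
    rw [Measure.restrict_apply hB, Measure.restrict_apply hB]
    have hB' := hB.inter (measurableSet_spanningSets (volume : Measure Plane) m)
    have hv : volume (B ∩ spanningSets (volume : Measure Plane) m) ≠ ∞ :=
      ((measure_mono inter_subset_right).trans_lt (measure_spanningSets_lt_top _ m)).ne
    rw [Measure.sum_apply _ hB', ← (hΦ.poisson a b ha hab).lintegral_eq hB'
      (intensity_ne_top hv _)]
    generalize B ∩ spanningSets (volume : Measure Plane) m = D at hB' 
    have h1 : ∀ ω, ((countIn x s a b D ω : ℕ∞) : ℝ≥0∞) =
        ∑' i, ({ω | s i ω ∈ Ioc a b} ∩ x i ⁻¹' D).indicator (fun _ => (1 : ℝ≥0∞)) ω := by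
      intro ω
      rw [countIn, ← ENNReal.tsum_set_one,
        tsum_subtype {i | s i ω ∈ Ioc a b ∧ x i ω ∈ D} (fun _ => (1 : ℝ≥0∞))]
      rfl
    have hm : ∀ i, MeasurableSet ({ω | s i ω ∈ Ioc a b} ∩ x i ⁻¹' D) := fun i =>
      (hs i).inter (hΦ.measurable_point i hB')
    simp only [h1]
    rw [MeasureTheory.lintegral_tsum fun i =>
      (measurable_const.indicator (hm i)).aemeasurable]
    refine tsum_congr fun i => ?_
    rw [lintegral_indicator_const (hm i), one_mul, Measure.map_apply (hΦ.measurable_point i) hB',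
      Measure.restrict_apply (hΦ.measurable_point i hB'), inter_comm]
  rw [← smul_eq_mul, ← lintegral_smul_measure, ← key, lintegral_sum_measure]
  refine tsum_congr fun i => ?_
  rw [lintegral_map hf (hΦ.measurable_point i), lintegral_indicator (hs i)]

/-- Independence of the slabs separates the two products, independence over disjoint cells separates
the factors, and every unit slab has the law of `(0, 1]`. The right side thus no longer depends on
`j` and `k`. -/
theorem IsSuperposedHPPP.integral_prod_pow (hΦ : IsSuperposedHPPP x s P) {ι : Type*} [Fintype ι]
    {B : ι → Set Plane} (hB : ∀ q, MeasurableSet (B q))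
    (hBd : Pairwise fun a b => Disjoint (B a) (B b)) (hv : ∀ q, volume (B q) ≠ ∞)
    (α β : ι → ℂ) {j k : ℕ} (hjk : j ≠ k) :
    ∫ ω, (∏ q, α q ^ (countIn x s j (j + 1) (B q) ω).toNat) *
        (∏ q, β q ^ (countIn x s k (k + 1) (B q) ω).toNat) ∂P =
      (∏ q, ∫ ω, α q ^ (countIn x s 0 1 (B q) ω).toNat ∂P) *
        ∏ q, ∫ ω, β q ^ (countIn x s 0 1 (B q) ω).toNat ∂P := by
  have hpp : ∀ l : ℕ, IsPoissonPointProcess (countIn x s l (l + 1)) (volume : Measure Plane) P := by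
    intro l
    simpa using hΦ.poisson l (l + 1) l.cast_nonneg (by linarith)
  have hlaw : ∀ (l : ℕ) (q : ι), HasLaw (countIn x s l (l + 1) (B q))
      ((poissonMeasure (volume (B q)).toNNReal).map (fun k : ℕ => (k : ℕ∞))) P :=
    fun l q => (hpp l).law (B q) (hB q) (hv q)
  have hind : IndepFun
      (fun ω (D : {D : Set Plane // MeasurableSet D}) => countIn x s j (j + 1) D.1 ω)
      (fun ω (D : {D : Set Plane // MeasurableSet D}) => countIn x s k (k + 1) D.1 ω) P := by
    have := (hΦ.indep (fun l => (l : ℝ)) (by simp) Nat.strictMono_cast).indepFun hjk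
    simpa using this
  have hmeas : ∀ γ : ι → ℂ, Measurable fun c : {D : Set Plane // MeasurableSet D} → ℕ∞ =>
      ∏ q, γ q ^ (c ⟨B q, hB q⟩).toNat := by
    intro γ
    refine Finset.measurable_prod _ fun q _ => ?_
    exact (measurable_of_countable (fun m : ℕ∞ => γ q ^ m.toNat)).comp (measurable_pi_apply _)
  have hone : ∀ (l : ℕ) (γ : ι → ℂ), AEStronglyMeasurable
      (fun ω => ∏ q, γ q ^ (countIn x s l (l + 1) (B q) ω).toNat) P := by
    intro l γ
    refine AEMeasurable.aestronglyMeasurable ?_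
    refine Finset.aemeasurable_fun_prod _ fun q _ => ?_
    exact (measurable_of_countable (fun m : ℕ∞ => γ q ^ m.toNat)).comp_aemeasurable
      (hlaw l q).aemeasurable
  have hmarg : ∀ (l : ℕ) (γ : ι → ℂ),
      ∫ ω, ∏ q, γ q ^ (countIn x s l (l + 1) (B q) ω).toNat ∂P =
        ∏ q, ∫ ω, γ q ^ (countIn x s 0 1 (B q) ω).toNat ∂P := by
    intro l γ
    rw [((hpp l).iIndepFun_of_fintype hB hBd).integral_fun_prod_comp
      (fun q => (hlaw l q).aemeasurable) (f := fun q m => γ q ^ m.toNat)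
      (fun q => (measurable_of_countable _).aestronglyMeasurable)]
    refine Finset.prod_congr rfl fun q _ => ?_
    have h0 := hlaw 0 q
    simp only [Nat.cast_zero, zero_add] at h0
    have e1 := (hlaw l q).integral_comp (f := fun m : ℕ∞ => γ q ^ m.toNat)
      (measurable_of_countable _).aestronglyMeasurable
    have e2 := h0.integral_comp (f := fun m : ℕ∞ => γ q ^ m.toNat)
      (measurable_of_countable _).aestronglyMeasurable
    exact e1.trans e2.symm
  have h2 := (hind.comp (hmeas α) (hmeas β)).integral_fun_mul_eq_mul_integral (hone j α) (hone k β)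
  rw [← hmarg j α, ← hmarg k β]
  exact h2

end PointProcess

/-! ### Marked sums over slabs of intensity -/

/-- The sum of `f (x i) * g i` over the points `x i` added between the levels `a` and `b`. -/
noncomputable def markSum {Ω : Type*} (f : Plane → ℝ≥0∞) (x : ℕ → Ω → Plane) (s : ℕ → Ω → ℝ)
    (g : ℕ → Ω → ℝ≥0) (a b : ℝ) (ω : Ω) : ℝ≥0∞ :=
  ∑' i, {i | s i ω ∈ Ioc a b}.indicator (fun i => f (x i ω) * g i ω) i

theorem markSum_mono_right {Ω : Type*} {x : ℕ → Ω → Plane} {s : ℕ → Ω → ℝ} {g : ℕ → Ω → ℝ≥0}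
    (f : Plane → ℝ≥0∞) (a : ℝ) {b c : ℝ} (hbc : b ≤ c) (ω : Ω) :
    markSum f x s g a b ω ≤ markSum f x s g a c ω :=
  ENNReal.tsum_le_tsum fun i => indicator_le_indicator_of_subset
    (s := {i | s i ω ∈ Ioc a b}) (t := {i | s i ω ∈ Ioc a c})
    (fun _ hi => Ioc_subset_Ioc_right hbc hi) (fun _ => zero_le) i

theorem markSum_natCast {Ω : Type*} {x : ℕ → Ω → Plane} {s : ℕ → Ω → ℝ} {g : ℕ → Ω → ℝ≥0}
    (f : Plane → ℝ≥0∞) (ω : Ω) (m : ℕ) :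
    markSum f x s g 0 m ω = ∑ k ∈ Finset.range m, markSum f x s g k (k + 1) ω := by
  induction m with
  | zero => simp [markSum]
  | succ m ih =>
    rw [Finset.sum_range_succ, ← ih, markSum, markSum, markSum, ← ENNReal.tsum_add]
    refine tsum_congr fun i => ?_
    push_cast
    have hd : Disjoint {i | s i ω ∈ Ioc (0 : ℝ) m} {i | s i ω ∈ Ioc (m : ℝ) (m + 1)} :=
      Set.disjoint_left.2 fun i h1 h2 => not_lt_of_ge h1.2 h2.1
    have hu : {i | s i ω ∈ Ioc (0 : ℝ) (m + 1)} =
        {i | s i ω ∈ Ioc (0 : ℝ) m} ∪ {i | s i ω ∈ Ioc (m : ℝ) (m + 1)} := by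
      ext i
      simp only [mem_ofPred_eq, mem_union]
      rw [← mem_union, Ioc_union_Ioc_eq_Ioc m.cast_nonneg (by linarith)]
    rw [hu, indicator_union_of_disjoint hd]

section MarkSum

variable {Ω : Type*} [MeasurableSpace Ω] {P : Measure Ω}
  {x : ℕ → Ω → Plane} {s : ℕ → Ω → ℝ} {g : ℕ → Ω → ℝ≥0}

theorem measurable_markSum {f : Plane → ℝ≥0∞} (hf : Measurable f) (hx : ∀ i, Measurable (x i))
    (hs : ∀ i, Measurable (s i)) (hg : ∀ i, Measurable (g i)) (a b : ℝ) :
    Measurable (markSum f x s g a b) := by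
  refine Measurable.tsum fun i => ?_
  have : (fun ω => {i | s i ω ∈ Ioc a b}.indicator (fun i => f (x i ω) * (g i ω : ℝ≥0∞)) i) =
      {ω | s i ω ∈ Ioc a b}.indicator (fun ω => f (x i ω) * (g i ω : ℝ≥0∞)) := rfl
  rw [this]
  exact ((hf.comp (hx i)).mul (hg i).coe_nnreal_ennreal).indicator (hs i measurableSet_Ioc)

theorem lintegral_markSum (hΦ : IsSuperposedHPPP x s P)
    (hg : ∀ i, Measurable (g i)) (hgd : ∀ i, IdentDistrib (g i) (g 0) P P)
    (hgz : IndepFun (fun ω i => g i ω) (fun ω i => (x i ω, s i ω)) P)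
    {f : Plane → ℝ≥0∞} (hf : Measurable f) {a b : ℝ} (ha : 0 ≤ a) (hab : a < b) :
    ∫⁻ ω, markSum f x s g a b ω ∂P =
      ENNReal.ofReal (b - a) * (∫⁻ p, f p) * ∫⁻ ω, g 0 ω ∂P := by
  have hs : ∀ i, MeasurableSet {ω | s i ω ∈ Ioc a b} := fun i =>
    hΦ.measurable_level i measurableSet_Ioc
  have hm : ∀ i, Measurable ({ω | s i ω ∈ Ioc a b}.indicator fun ω => f (x i ω)) := fun i =>
    (hf.comp (hΦ.measurable_point i)).indicator (hs i)
  have hterm : ∀ i ω, {i | s i ω ∈ Ioc a b}.indicator (fun i => f (x i ω) * (g i ω : ℝ≥0∞)) i =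
      {ω | s i ω ∈ Ioc a b}.indicator (fun ω => f (x i ω)) ω * g i ω := by
    intro i ω
    by_cases h : s i ω ∈ Ioc a b <;> simp [indicator]
  simp only [markSum, hterm]
  rw [lintegral_tsum fun i => (hm i).aemeasurable.fun_mul
    (hg i).coe_nnreal_ennreal.aemeasurable,
    ← hΦ.lintegral_tsum ha hab hf, ← ENNReal.tsum_mul_right]
  refine tsum_congr fun i => ?_
  have hind : IndepFun ({ω | s i ω ∈ Ioc a b}.indicator fun ω => f (x i ω))
      (fun ω => (g i ω : ℝ≥0∞)) P := by
    have hφ : Measurable fun c : ℕ → Plane × ℝ =>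
        (univ ×ˢ Ioc a b : Set (Plane × ℝ)).indicator (fun p => f p.1) (c i) :=
      ((hf.comp measurable_fst).indicator (MeasurableSet.univ.prod measurableSet_Ioc)).comp
        (measurable_pi_apply i)
    have hψ : Measurable fun c : ℕ → ℝ≥0 => ((c i : ℝ≥0) : ℝ≥0∞) :=
      (measurable_pi_apply i).coe_nnreal_ennreal
    have h := hgz.symm.comp hφ hψ
    refine h.congr (ae_of_all _ fun ω => ?_) (ae_of_all _ fun ω => rfl)
    by_cases h : s i ω ∈ Ioc a b <;> simp [indicator]
  have h2 := lintegral_mul_eq_lintegral_mul_lintegral_of_indepFun (hm i)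
    (hg i).coe_nnreal_ennreal hind
  refine h2.trans ?_
  congr 1
  exact ((hgd i).comp measurable_coe_nnreal_ennreal).lintegral_eq

variable [IsProbabilityMeasure P]

/-- The joint characteristic function factors through one `θ`, the same for both slabs and for every
pair. This contains independence and equality in law at once: setting `u` or `v` to `0` recovers the
marginals. -/
theorem exists_integral_exp_markSum_step (hΦ : IsSuperposedHPPP x s P)
    (hg : ∀ i, Measurable (g i)) (hgi : iIndepFun g P)
    (hgd : ∀ i, IdentDistrib (g i) (g 0) P P)
    (hgz : IndepFun (fun ω i => g i ω) (fun ω i => (x i ω, s i ω)) P)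
    {ι : Type*} [Fintype ι] {B : ι → Set Plane} (hB : ∀ q, MeasurableSet (B q))
    (hBd : Pairwise fun a b => Disjoint (B a) (B b)) (hv : ∀ q, volume (B q) ≠ ∞)
    (c : ι → ℝ≥0) {f : Plane → ℝ≥0∞} (hf : ∀ p, f p = ∑ q, (B q).indicator (fun _ => (c q : ℝ≥0∞)) p) :
    ∃ θ : ℝ → ℂ, ∀ (u v : ℝ) (j k : ℕ), j ≠ k →
      ∫ ω, Complex.exp ((u * (markSum f x s g j (j + 1) ω).toReal +
        v * (markSum f x s g k (k + 1) ω).toReal : ℝ) * Complex.I) ∂P = θ u * θ v := by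
  set G : ℕ → Ω → ℝ := fun i ω => g i ω with hGdef
  have hG : ∀ i, Measurable (G i) := fun i => (hg i).coe_nnreal_real
  have hGi : iIndepFun G P := hgi.comp (fun _ (y : ℝ≥0) => (y : ℝ)) fun _ => measurable_coe_nnreal_real
  have hGd : ∀ i, IdentDistrib (G i) (G 0) P P := fun i => (hgd i).comp measurable_coe_nnreal_real
  have hGz : IndepFun (fun ω i => G i ω) (fun ω i => (x i ω, s i ω)) P := by
    have : Measurable fun (c : ℕ → ℝ≥0) i => ((c i : ℝ≥0) : ℝ) :=
      measurable_pi_lambda _ fun i => (measurable_pi_apply i).coe_nnreal_real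
    exact hgz.comp this measurable_id
  refine ⟨fun u => ∏ q, ∫ ω, charFun (P.map (G 0)) (u * c q) ^ (countIn x s 0 1 (B q) ω).toNat ∂P,
    fun u v j k hjk => ?_⟩
  rw [← hΦ.integral_prod_pow hB hBd hv _ _ hjk]
  -- Both slab sums together form one weighted sum over disjoint cells in position and level, with
  -- weights `u * c q` on the first slab and `v * c q` on the second.
  let C : ι ⊕ ι → Set (Plane × ℝ) := Sum.elim (fun q => B q ×ˢ Ioc (j : ℝ) (j + 1))
    (fun q => B q ×ˢ Ioc (k : ℝ) (k + 1))
  have hC : ∀ a, MeasurableSet (C a) := by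
    rintro (q | q) <;> exact (hB q).prod measurableSet_Ioc
  have hslab : ∀ {j k : ℕ}, j ≠ k → Disjoint (Ioc (j : ℝ) (j + 1)) (Ioc (k : ℝ) (k + 1)) := by
    intro j k hjk
    refine Set.disjoint_left.2 fun y h1 h2 => ?_
    rcases lt_or_gt_of_ne hjk with h | h
    · have : (j : ℝ) + 1 ≤ k := by exact_mod_cast h
      linarith [h1.2, h2.1]
    · have : (k : ℝ) + 1 ≤ j := by exact_mod_cast h
      linarith [h2.2, h1.1]
  have hCd : Pairwise fun a b => Disjoint (C a) (C b) := by
    rintro (q | q) (r | r) hqr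
    · exact Disjoint.set_prod_left (hBd fun h => hqr (congrArg _ h)) _ _
    · exact Disjoint.set_prod_right (hslab hjk) _ _
    · exact Disjoint.set_prod_right (hslab hjk.symm) _ _
    · exact Disjoint.set_prod_left (hBd fun h => hqr (congrArg _ h)) _ _
  have hmem : ∀ (l : ℕ) (q : ι) (ω : Ω), {i | (x i ω, s i ω) ∈ B q ×ˢ Ioc (l : ℝ) (l + 1)} =
      {i | s i ω ∈ Ioc (l : ℝ) (l + 1) ∧ x i ω ∈ B q} := fun l q ω => by
    ext i
    simp only [mem_ofPred_eq, mem_prod]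
    exact and_comm
  have hfin' : ∀ l : ℕ, ∀ᵐ ω ∂P, ∀ q,
      {i | (x i ω, s i ω) ∈ B q ×ˢ Ioc (l : ℝ) (l + 1)}.Finite := fun l => by
    simp only [hmem]
    exact ae_all_iff.2 fun q => hΦ.ae_finite l.cast_nonneg (by linarith) (hB q) (hv q)
  have hfin : ∀ᵐ ω ∂P, ∀ a, {i | (x i ω, s i ω) ∈ C a}.Finite := by
    filter_upwards [hfin' j, hfin' k] with ω h1 h2
    rintro (q | q)
    exacts [h1 q, h2 q]
  have key := integral_exp_tsum_marks (z := fun i ω => (x i ω, s i ω)) hC hCd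
    (fun i => (hΦ.measurable_point i).prodMk (hΦ.measurable_level i)) hG hGi hGd hGz hfin
    (Sum.elim (fun q => u * c q) (fun q => v * c q))
  have hone : ∀ (l : ℕ) (u : ℝ) (ω : Ω),
      (∀ q, {i | (x i ω, s i ω) ∈ B q ×ˢ Ioc (l : ℝ) (l + 1)}.Finite) →
      HasSum (fun i => (∑ q, (B q ×ˢ Ioc (l : ℝ) (l + 1)).indicator (fun _ => u * (c q : ℝ))
        (x i ω, s i ω)) * G i ω) (u * (markSum f x s g l (l + 1) ω).toReal) := by
    intro l u ω hω
    have hterm : ∀ i, (∑ q, (B q ×ˢ Ioc (l : ℝ) (l + 1)).indicator (fun _ => u * (c q : ℝ))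
        (x i ω, s i ω)) * G i ω = u * ({i | s i ω ∈ Ioc (l : ℝ) (l + 1)}.indicator
          (fun i => f (x i ω) * (g i ω : ℝ≥0∞)) i).toReal := by
      intro i
      by_cases hi : s i ω ∈ Ioc (l : ℝ) (l + 1)
      · have h1 : (f (x i ω)).toReal = ∑ q, (B q).indicator (fun _ => (c q : ℝ)) (x i ω) := by
          rw [hf, ENNReal.toReal_sum]
          · refine Finset.sum_congr rfl fun q _ => ?_
            by_cases h : x i ω ∈ B q <;> simp [h]
          · intro q _
            by_cases h : x i ω ∈ B q <;> simp [h]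
        rw [indicator_of_mem (by exact hi), ENNReal.toReal_mul, h1,
          hGdef]
        simp only [ENNReal.coe_toReal]
        rw [← mul_assoc, Finset.mul_sum]
        congr 1
        refine Finset.sum_congr rfl fun q _ => ?_
        by_cases h : x i ω ∈ B q <;> simp [indicator, h, hi.1, hi.2]
      · rw [indicator_of_notMem (by exact hi), Finset.sum_eq_zero]
        · simp
        · intro q _
          exact indicator_of_notMem (fun h => hi h.2) _
    have hsum : Summable (fun i => (∑ q, (B q ×ˢ Ioc (l : ℝ) (l + 1)).indicator
        (fun _ => u * (c q : ℝ)) (x i ω, s i ω)) * G i ω) := by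
      refine summable_of_hasFiniteSupport ((Set.finite_iUnion hω).subset ?_)
      intro i hi
      by_contra hcon
      simp only [mem_iUnion, mem_ofPred_eq, not_exists] at hcon
      apply hi
      simp only
      rw [Finset.sum_eq_zero fun q _ => indicator_of_notMem (hcon q) _, zero_mul]
    convert! hsum.hasSum using 1
    simp only [hterm]
    rw [tsum_mul_left, markSum, ENNReal.tsum_toReal_eq]
    intro i
    by_cases hi : s i ω ∈ Ioc (l : ℝ) (l + 1)
    · rw [indicator_of_mem (by exact hi), hf]
      refine ENNReal.mul_ne_top (ENNReal.sum_ne_top.2 fun q _ => ?_) ENNReal.coe_ne_top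
      by_cases h : x i ω ∈ B q <;> simp [h]
    · rw [indicator_of_notMem (by exact hi)]
      exact ENNReal.zero_ne_top
  refine Eq.trans (integral_congr_ae ?_) (key.trans (integral_congr_ae (ae_of_all _ fun ω => ?_)))
  · filter_upwards [hfin' j, hfin' k] with ω h1 h2
    have := ((hone j u ω h1).add (hone k v ω h2)).tsum_eq
    simp only [← this, Fintype.sum_sum_type, C, Sum.elim_inl, Sum.elim_inr, add_mul]
  · simp only [Fintype.prod_sum_type, C, Sum.elim_inl, Sum.elim_inr, hmem]
    rfl

end MarkSum

/-- Monotone convergence for the counting measure. -/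
theorem tendsto_markSum_eapprox {Ω : Type*} {x : ℕ → Ω → Plane} {s : ℕ → Ω → ℝ}
    {g : ℕ → Ω → ℝ≥0} {f : Plane → ℝ≥0∞} (hf : Measurable f) (a b : ℝ) (ω : Ω) :
    Tendsto (fun m => markSum (SimpleFunc.eapprox f m) x s g a b ω) atTop
      (𝓝 (markSum f x s g a b ω)) := by
  simp only [markSum, ← lintegral_count]
  refine lintegral_tendsto_of_tendsto_of_monotone (fun _ => (measurable_of_countable _).aemeasurable)
    (ae_of_all _ fun i m m' h => ?_) (ae_of_all _ fun i => ?_)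
  · exact indicator_le_indicator (mul_le_mul_left (SimpleFunc.monotone_eapprox f h _) _)
  · by_cases hi : s i ω ∈ Ioc a b
    · simp only [indicator, mem_ofPred_eq, hi, if_true]
      exact ENNReal.Tendsto.mul_const (SimpleFunc.tendsto_eapprox hf _) (Or.inr ENNReal.coe_ne_top)
    · simp only [indicator, mem_ofPred_eq, hi, if_false]
      exact tendsto_const_nhds

/-! ### Independence of slab sums and the strong law -/

section StrongLaw

variable {Ω : Type*} [MeasurableSpace Ω] {P : Measure Ω}
  {x : ℕ → Ω → Plane} {s : ℕ → Ω → ℝ} {g : ℕ → Ω → ℝ≥0}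

theorem ae_markSum_ne_top (hΦ : IsSuperposedHPPP x s P)
    (hg : ∀ i, Measurable (g i)) (hgd : ∀ i, IdentDistrib (g i) (g 0) P P)
    (hgz : IndepFun (fun ω i => g i ω) (fun ω i => (x i ω, s i ω)) P)
    (hgint : ∫⁻ ω, g 0 ω ∂P ≠ ∞) {f : Plane → ℝ≥0∞} (hf : Measurable f)
    (hfint : ∫⁻ p, f p ≠ ∞) {a b : ℝ} (ha : 0 ≤ a) (hab : a < b) :
    ∀ᵐ ω ∂P, markSum f x s g a b ω ≠ ∞ := by
  have h := lintegral_markSum hΦ hg hgd hgz hf ha hab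
  have h2 : ∫⁻ ω, markSum f x s g a b ω ∂P ≠ ∞ := by
    rw [h]
    exact ENNReal.mul_ne_top (ENNReal.mul_ne_top ENNReal.ofReal_ne_top hfint) hgint
  filter_upwards [ae_lt_top (measurable_markSum hf hΦ.measurable_point hΦ.measurable_level hg a b)
    h2] with ω hω using hω.ne

variable [IsProbabilityMeasure P]

theorem integral_exp_markSum_add (hΦ : IsSuperposedHPPP x s P)
    (hg : ∀ i, Measurable (g i)) (hgi : iIndepFun g P)
    (hgd : ∀ i, IdentDistrib (g i) (g 0) P P)
    (hgz : IndepFun (fun ω i => g i ω) (fun ω i => (x i ω, s i ω)) P)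
    (hgint : ∫⁻ ω, g 0 ω ∂P ≠ ∞) {f : Plane → ℝ≥0∞} (hf : Measurable f)
    (hfint : ∫⁻ p, f p ≠ ∞) (u v : ℝ) {j k : ℕ} (hjk : j ≠ k) :
    ∫ ω, Complex.exp ((u * (markSum f x s g j (j + 1) ω).toReal +
        v * (markSum f x s g k (k + 1) ω).toReal : ℝ) * Complex.I) ∂P =
      (∫ ω, Complex.exp ((u * (markSum f x s g 0 1 ω).toReal : ℝ) * Complex.I) ∂P) *
        ∫ ω, Complex.exp ((v * (markSum f x s g 0 1 ω).toReal : ℝ) * Complex.I) ∂P := by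
  have hstep : ∀ m, ∃ θ : ℝ → ℂ, ∀ (u v : ℝ) (j k : ℕ), j ≠ k →
      ∫ ω, Complex.exp ((u * (markSum (SimpleFunc.eapprox f m) x s g j (j + 1) ω).toReal +
        v * (markSum (SimpleFunc.eapprox f m) x s g k (k + 1) ω).toReal : ℝ) * Complex.I) ∂P =
        θ u * θ v := by
    intro m
    set h := SimpleFunc.eapprox f m with hh
    -- The value `0` is dropped so that each level set lies in the support, which has finite volume
    -- because `∫ f` is finite.
    let ι := {c // c ∈ h.range.filter (· ≠ 0)}
    let _ : Fintype ι := inferInstanceAs (Fintype {c // c ∈ h.range.filter (· ≠ 0)})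
    have hc : ∀ q : ι, q.1 ∈ range h ∧ q.1 ≠ 0 := fun q => by
      have := q.2
      rwa [Finset.mem_filter, SimpleFunc.mem_range] at this
    have hctop : ∀ q : ι, q.1 ≠ ∞ := fun q => by
      obtain ⟨p, hp⟩ := (hc q).1
      rw [← hp]
      exact (SimpleFunc.eapprox_lt_top f m p).ne
    refine exists_integral_exp_markSum_step hΦ hg hgi hgd hgz (ι := ι)
      (B := fun q => h ⁻¹' {q.1}) (fun q => h.measurableSet_fiber _) ?_ ?_
      (fun q => q.1.toNNReal) ?_
    · intro q r hqr
      exact Disjoint.preimage _ (disjoint_singleton.2 fun e => hqr (Subtype.ext e))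
    · intro q
      refine ((measure_mono ?_).trans_lt
        (measure_support_eapprox_lt_top hf hfint m)).ne
      intro p hp
      have : h p = q.1 := hp
      rw [Function.mem_support, ← hh, this]
      exact (hc q).2
    · intro p
      by_cases hp : h p = 0
      · rw [hp, Finset.sum_eq_zero]
        intro q _
        refine indicator_of_notMem (fun hq => (hc q).2 ?_) _
        exact (show h p = q.1 from hq).symm.trans hp
      · have hmem : h p ∈ h.range.filter (· ≠ 0) :=
          Finset.mem_filter.2 ⟨h.mem_range_self p, hp⟩
        rw [Finset.sum_eq_single (⟨h p, hmem⟩ : ι)]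
        · rw [indicator_of_mem (by simp), ENNReal.coe_toNNReal (hctop ⟨h p, hmem⟩)]
        · intro q _ hq
          refine indicator_of_notMem (fun hq' => hq (Subtype.ext ?_)) _
          exact (show h p = q.1 from hq').symm
        · simp
  have hlim : ∀ (u v : ℝ) (j k : ℕ), Tendsto (fun m => ∫ ω,
      Complex.exp ((u * (markSum (SimpleFunc.eapprox f m) x s g j (j + 1) ω).toReal +
        v * (markSum (SimpleFunc.eapprox f m) x s g k (k + 1) ω).toReal : ℝ) * Complex.I) ∂P) atTop
      (𝓝 (∫ ω, Complex.exp ((u * (markSum f x s g j (j + 1) ω).toReal +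
        v * (markSum f x s g k (k + 1) ω).toReal : ℝ) * Complex.I) ∂P)) := by
    intro u v j k
    refine tendsto_integral_of_dominated_convergence (fun _ => 1) (fun m => ?_)
      (integrable_const _) (fun m => ae_of_all _ fun ω => (Complex.norm_exp_ofReal_mul_I _).le) ?_
    · have : ∀ a b : ℝ, Measurable (markSum (SimpleFunc.eapprox f m) x s g a b) := fun a b =>
        measurable_markSum (SimpleFunc.measurable _) hΦ.measurable_point hΦ.measurable_level hg a b
      have h1 := (this j (j + 1)).ennreal_toReal
      have h2 := (this k (k + 1)).ennreal_toReal
      exact Measurable.aestronglyMeasurable (by fun_prop)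
    · filter_upwards [ae_markSum_ne_top hΦ hg hgd hgz hgint hf hfint j.cast_nonneg
        (lt_add_one (j : ℝ)), ae_markSum_ne_top hΦ hg hgd hgz hgint hf hfint k.cast_nonneg
        (lt_add_one (k : ℝ))] with ω h1 h2
      have e1 := (ENNReal.tendsto_toReal h1).comp (tendsto_markSum_eapprox hf (j : ℝ) (j + 1) ω)
      have e2 := (ENNReal.tendsto_toReal h2).comp (tendsto_markSum_eapprox hf (k : ℝ) (k + 1) ω)
      exact (Complex.continuous_exp.tendsto _).comp (((Complex.continuous_ofReal.tendsto _).comp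
        ((e1.const_mul u).add (e2.const_mul v))).mul_const _)
  -- `θ` depends on `m`, so it is eliminated before the limit: `u = v = 0` gives `θ 0 * θ 0 = 1`,
  -- hence `θ u * θ v = (θ u * θ 0) * (θ v * θ 0)`, and each bracket is an integral whose limit is
  -- known.
  have hfac : ∀ m, ∫ ω,
      Complex.exp ((u * (markSum (SimpleFunc.eapprox f m) x s g j (j + 1) ω).toReal +
        v * (markSum (SimpleFunc.eapprox f m) x s g k (k + 1) ω).toReal : ℝ) * Complex.I) ∂P =
      (∫ ω, Complex.exp ((u * (markSum (SimpleFunc.eapprox f m) x s g (0 : ℕ) ((0 : ℕ) + 1) ω).toReal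
        + 0 * (markSum (SimpleFunc.eapprox f m) x s g (1 : ℕ) ((1 : ℕ) + 1) ω).toReal : ℝ)
          * Complex.I) ∂P) *
      ∫ ω, Complex.exp ((v * (markSum (SimpleFunc.eapprox f m) x s g (0 : ℕ) ((0 : ℕ) + 1) ω).toReal
        + 0 * (markSum (SimpleFunc.eapprox f m) x s g (1 : ℕ) ((1 : ℕ) + 1) ω).toReal : ℝ)
          * Complex.I) ∂P := by
    intro m
    obtain ⟨θ, hθ⟩ := hstep m
    have h0 := hθ 0 0 0 1 zero_ne_one
    simp only [zero_mul, add_zero, Complex.ofReal_zero, Complex.exp_zero, integral_const,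
      probReal_univ, one_smul] at h0
    rw [hθ u v j k hjk, hθ u 0 0 1 zero_ne_one, hθ v 0 0 1 zero_ne_one]
    linear_combination (θ u * θ v) * h0
  have := tendsto_nhds_unique (hlim u v j k)
    (((hlim u 0 0 1).mul (hlim v 0 0 1)).congr fun m => (hfac m).symm)
  simpa using this

theorem indepFun_toReal_markSum (hΦ : IsSuperposedHPPP x s P)
    (hg : ∀ i, Measurable (g i)) (hgi : iIndepFun g P)
    (hgd : ∀ i, IdentDistrib (g i) (g 0) P P)
    (hgz : IndepFun (fun ω i => g i ω) (fun ω i => (x i ω, s i ω)) P)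
    (hgint : ∫⁻ ω, g 0 ω ∂P ≠ ∞) {f : Plane → ℝ≥0∞} (hf : Measurable f)
    (hfint : ∫⁻ p, f p ≠ ∞) {j k : ℕ} (hjk : j ≠ k) :
    IndepFun (fun ω => (markSum f x s g j (j + 1) ω).toReal)
      (fun ω => (markSum f x s g k (k + 1) ω).toReal) P ∧
    IdentDistrib (fun ω => (markSum f x s g j (j + 1) ω).toReal)
      (fun ω => (markSum f x s g 0 1 ω).toReal) P P := by
  have hm : ∀ a b : ℝ, Measurable fun ω => (markSum f x s g a b ω).toReal := fun a b =>
    (measurable_markSum hf hΦ.measurable_point hΦ.measurable_level hg a b).ennreal_toReal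
  have hcf : ∀ (a b u : ℝ), charFun (P.map fun ω => (markSum f x s g a b ω).toReal) u =
      ∫ ω, Complex.exp ((u * (markSum f x s g a b ω).toReal : ℝ) * Complex.I) ∂P := by
    intro a b u
    rw [charFun_apply_real, integral_map (hm a b).aemeasurable (by fun_prop)]
    simp
  have hmul := fun u v => integral_exp_markSum_add hΦ hg hgi hgd hgz hgint hf hfint u v hjk
  have hj : ∀ u, charFun (P.map fun ω => (markSum f x s g j (j + 1) ω).toReal) u =
      charFun (P.map fun ω => (markSum f x s g 0 1 ω).toReal) u := by
    intro u
    have := hmul u 0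
    simp only [zero_mul, add_zero, Complex.ofReal_zero, Complex.exp_zero, integral_const,
      probReal_univ, one_smul, mul_one] at this
    rw [hcf, hcf, this]
  have hk : ∀ v, charFun (P.map fun ω => (markSum f x s g k (k + 1) ω).toReal) v =
      charFun (P.map fun ω => (markSum f x s g 0 1 ω).toReal) v := by
    intro v
    have := hmul 0 v
    simp only [zero_mul, zero_add, Complex.ofReal_zero, Complex.exp_zero, integral_const,
      probReal_univ, one_smul, one_mul] at this
    rw [hcf, hcf, this]
  have := fun a b => Measure.isProbabilityMeasure_map (μ := P) (hm a b).aemeasurable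
  refine ⟨(indepFun_iff_charFun_prod (hm _ _).aemeasurable (hm _ _).aemeasurable).2 fun t => ?_,
    ⟨(hm _ _).aemeasurable, (hm _ _).aemeasurable, Measure.ext_of_charFun (funext hj)⟩⟩
  rw [hj, hk, hcf, hcf, ← hmul, charFun_apply, integral_map (by fun_prop) (by fun_prop)]
  simp [WithLp.prod_inner_apply]

/-- The strong law of large numbers for nonnegatively marked points along the superposition. -/
theorem ae_tendsto_markSum_div (hΦ : IsSuperposedHPPP x s P)
    (hg : ∀ i, Measurable (g i)) (hgi : iIndepFun g P)
    (hgd : ∀ i, IdentDistrib (g i) (g 0) P P)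
    (hgz : IndepFun (fun ω i => g i ω) (fun ω i => (x i ω, s i ω)) P)
    (hgint : ∫⁻ ω, g 0 ω ∂P ≠ ∞) {f : Plane → ℝ≥0∞} (hf : Measurable f)
    (hfint : ∫⁻ p, f p ≠ ∞) :
    ∀ᵐ ω ∂P, (∀ lam, markSum f x s g 0 lam ω ≠ ∞) ∧
      Tendsto (fun lam => (markSum f x s g 0 lam ω).toReal / lam) atTop
        (𝓝 ((∫⁻ p, f p).toReal * (∫⁻ ω, g 0 ω ∂P).toReal)) := by
  have hm : ∀ a b : ℝ, Measurable (markSum f x s g a b) := fun a b =>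
    measurable_markSum hf hΦ.measurable_point hΦ.measurable_level hg a b
  let X : ℕ → Ω → ℝ := fun k ω => (markSum f x s g k (k + 1) ω).toReal
  have hX0 : X 0 = fun ω => (markSum f x s g 0 1 ω).toReal := by
    funext ω
    simp [X]
  have hmean := lintegral_markSum hΦ hg hgd hgz hf le_rfl zero_lt_one
  simp only [sub_zero, ENNReal.ofReal_one, one_mul] at hmean
  have hne : ∫⁻ ω, markSum f x s g 0 1 ω ∂P ≠ ∞ := by
    rw [hmean]
    exact ENNReal.mul_ne_top hfint hgint
  have hint : Integrable (X 0) P := by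
    rw [hX0]
    exact integrable_toReal_of_lintegral_ne_top (hm 0 1).aemeasurable hne
  -- Pairwise independence suffices here. For the law of slab `j`, slab `j + 1` serves as an
  -- arbitrary partner.
  have hslln := strong_law_ae_real X hint
    (fun j k hjk => (indepFun_toReal_markSum hΦ hg hgi hgd hgz hgint hf hfint hjk).1)
    (fun j => by
      rw [hX0]
      exact (indepFun_toReal_markSum hΦ hg hgi hgd hgz hgint hf hfint j.succ_ne_self.symm).2)
  have hEX : ∫ ω, X 0 ω ∂P = (∫⁻ p, f p).toReal * (∫⁻ ω, g 0 ω ∂P).toReal := by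
    rw [hX0, integral_toReal (hm 0 1).aemeasurable
      (ae_markSum_ne_top hΦ hg hgd hgz hgint hf hfint le_rfl zero_lt_one |>.mono
        fun ω h => h.lt_top), hmean, ENNReal.toReal_mul]
  rw [hEX] at hslln
  have hfin : ∀ᵐ ω ∂P, ∀ k : ℕ, markSum f x s g k (k + 1) ω ≠ ∞ := ae_all_iff.2 fun k =>
    ae_markSum_ne_top hΦ hg hgd hgz hgint hf hfint k.cast_nonneg (lt_add_one (k : ℝ))
  filter_upwards [hslln, hfin] with ω hω hk
  have hnat : ∀ m : ℕ, markSum f x s g 0 m ω ≠ ∞ := fun m => by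
    rw [markSum_natCast]
    exact ENNReal.sum_ne_top.2 fun k _ => hk k
  have hfin' : ∀ lam, markSum f x s g 0 lam ω ≠ ∞ := fun lam =>
    ((markSum_mono_right f 0 (Nat.le_ceil lam) ω).trans_lt (hnat _).lt_top).ne
  refine ⟨hfin', ?_⟩
  set c := (∫⁻ p, f p).toReal * (∫⁻ ω, g 0 ω ∂P).toReal
  have hseq : Tendsto (fun m : ℕ => (markSum f x s g 0 m ω).toReal / m) atTop (𝓝 c) := by
    refine hω.congr fun m => ?_
    rw [markSum_natCast, ENNReal.toReal_sum fun k _ => hk k]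
  have hmono : ∀ {b c : ℝ}, b ≤ c →
      (markSum f x s g 0 b ω).toReal ≤ (markSum f x s g 0 c ω).toReal := fun h =>
    ENNReal.toReal_mono (hfin' _) (markSum_mono_right f 0 h ω)
  -- Nonnegative marks make the sum monotone in the intensity, so it lies between its values at the
  -- floor and the ceiling, both asymptotic to `lam`.
  have hlow : Tendsto (fun lam : ℝ => (markSum f x s g 0 ⌊lam⌋₊ ω).toReal / ⌊lam⌋₊ *
      (⌊lam⌋₊ / lam)) atTop (𝓝 (c * 1)) :=
    (hseq.comp tendsto_nat_floor_atTop).mul tendsto_nat_floor_div_atTop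
  have hup : Tendsto (fun lam : ℝ => (markSum f x s g 0 ⌈lam⌉₊ ω).toReal / ⌈lam⌉₊ *
      (⌈lam⌉₊ / lam)) atTop (𝓝 (c * 1)) :=
    (hseq.comp tendsto_nat_ceil_atTop).mul tendsto_nat_ceil_div_atTop
  rw [mul_one] at hlow hup
  refine tendsto_of_tendsto_of_tendsto_of_le_of_le' hlow hup ?_ ?_
  · filter_upwards [eventually_ge_atTop 1] with lam hlam
    have h1 : (0 : ℝ) < ⌊lam⌋₊ := by exact_mod_cast Nat.floor_pos.2 hlam
    rw [div_mul_div_cancel₀ h1.ne']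
    exact div_le_div_of_nonneg_right (hmono (Nat.floor_le (by linarith))) (by linarith)
  · filter_upwards [eventually_ge_atTop 1] with lam hlam
    have h1 : (0 : ℝ) < ⌈lam⌉₊ := by exact_mod_cast Nat.ceil_pos.2 (by linarith)
    rw [div_mul_div_cancel₀ h1.ne']
    exact div_le_div_of_nonneg_right (hmono (Nat.le_ceil lam)) (by linarith)

end StrongLaw

/-! ### Path loss in polar coordinates -/

section PathLoss

variable {L : ℝ → ℝ}

theorem PhysicallyFeasible.integrable_norm (hL : PhysicallyFeasible L) :
    Integrable (fun p : Plane => L ‖p‖) := by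
  rw [integrable_fun_norm_addHaar]
  simpa using hL.integrable

/-- The factor `2π` is the dimension times the area of the unit disk. -/
theorem PhysicallyFeasible.integral_norm : ∫ p : Plane, L ‖p‖ = 2 * Real.pi * pathGamma L := by
  rw [integral_fun_norm_addHaar]
  simp [pathGamma, measureReal_def, EuclideanSpace.volume_ball_fin_two,
    ENNReal.toReal_ofReal Real.pi_nonneg]
  ring

end PathLoss

theorem nthDist_le {Ω : Type*} {x : ℕ → Ω → Plane} {s : ℕ → Ω → ℝ} {n : ℕ} {lam r : ℝ} {ω : Ω}
    (h : ((n + 1 : ℕ) : ℕ∞) ≤ countIn x s 0 lam (Metric.closedBall 0 r) ω) :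
    nthDist x s n lam ω ≤ r := by
  -- Closed balls of negative radius are empty and hold no points, so `0` is a lower bound.
  refine csInf_le ⟨0, fun y hy => ?_⟩ h
  by_contra hneg
  have hy' : ((n + 1 : ℕ) : ℕ∞) ≤ countIn x s 0 lam (Metric.closedBall 0 y) ω := hy
  rw [Metric.closedBall_eq_empty.2 (not_le.1 hneg)] at hy'
  simp [countIn] at hy'

/-! ### Pathwise estimates for a fixed outcome -/

section Deterministic

variable {Ω : Type*} {x : ℕ → Ω → Plane} {s : ℕ → Ω → ℝ} {ω : Ω}

/-- Makes the strong law applicable to counts, as sums with unit marks. -/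
theorem markSum_indicator_one (D : Set Plane) (lam : ℝ) :
    markSum (D.indicator fun _ => 1) x s (fun _ _ => 1) 0 lam ω = countIn x s 0 lam D ω := by
  rw [markSum, countIn, ← ENNReal.tsum_set_one,
    tsum_subtype {i | s i ω ∈ Ioc 0 lam ∧ x i ω ∈ D} (fun _ => (1 : ℝ≥0∞))]
  refine tsum_congr fun i => ?_
  by_cases h1 : s i ω ∈ Ioc 0 lam <;> by_cases h2 : x i ω ∈ D <;> simp [indicator, h2]

theorem eventually_nthDist_le {D : ℝ} {r : ℝ} (hD : 0 < D)
    (h : Tendsto (fun lam => (markSum ((Metric.closedBall 0 r).indicator fun _ => 1) x s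
      (fun _ _ => 1) 0 lam ω).toReal / lam) atTop (𝓝 D)) (n : ℕ) :
    ∀ᶠ lam in atTop, nthDist x s n lam ω ≤ r := by
  have h1 := h.pos_mul_atTop hD tendsto_id
  filter_upwards [h1.eventually_gt_atTop (n + 1 : ℝ), eventually_gt_atTop 0] with lam hlam hpos
  refine nthDist_le ?_
  rw [id, div_mul_cancel₀ _ hpos.ne', markSum_indicator_one] at hlam
  by_contra hcon
  have hle : countIn x s 0 lam (Metric.closedBall 0 r) ω ≤ ((n + 1 : ℕ) : ℕ∞) := (not_le.1 hcon).le
  have h2 : ((countIn x s 0 lam (Metric.closedBall 0 r) ω : ℕ∞) : ℝ≥0∞).toReal ≤ (n + 1 : ℕ) := by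
    have := ENNReal.toReal_mono (ENNReal.natCast_ne_top (n + 1))
      ((ENat.toENNReal_le.2 hle).trans_eq (ENat.toENNReal_coe (n + 1)))
    rwa [ENNReal.toReal_natCast] at this
  push_cast at h2
  linarith

variable {L : ℝ → ℝ} {g : ℕ → Ω → ℝ} {f : Plane → ℝ≥0∞}

theorem hasSum_fullSum (hfL : ∀ i, 0 < s i ω → L ‖x i ω‖ = (f (x i ω)).toReal) {lam : ℝ}
    (hp : markSum f x s (fun i ω => (g i ω).toNNReal) 0 lam ω ≠ ∞)
    (hn : markSum f x s (fun i ω => (-g i ω).toNNReal) 0 lam ω ≠ ∞) :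
    HasSum ({i | s i ω ∈ Ioc 0 lam}.indicator fun i => L ‖x i ω‖ * g i ω)
      ((markSum f x s (fun i ω => (g i ω).toNNReal) 0 lam ω).toReal -
        (markSum f x s (fun i ω => (-g i ω).toNNReal) 0 lam ω).toReal) := by
  have h1 := ENNReal.hasSum_toReal hp
  have h2 := ENNReal.hasSum_toReal hn
  rw [← ENNReal.tsum_toReal_eq (ENNReal.ne_top_of_tsum_ne_top hp)] at h1
  rw [← ENNReal.tsum_toReal_eq (ENNReal.ne_top_of_tsum_ne_top hn)] at h2
  convert! h1.sub h2 using 1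
  funext i
  by_cases h : s i ω ∈ Ioc 0 lam
  · simp only [indicator, mem_ofPred_eq, h, if_true, ENNReal.toReal_mul, ENNReal.coe_toReal,
      hfL i h.1, ← mul_sub]
    rw [Real.coe_toNNReal', Real.coe_toNNReal', max_zero_sub_max_neg_zero_eq_self]
  · have h' : i ∉ {i | s i ω ∈ Ioc 0 lam} := h
    simp only [indicator_of_notMem h', ENNReal.toReal_zero, sub_zero]

theorem outsideTerm_eq_indicator {Ω : Type*} (L : ℝ → ℝ) (x : ℕ → Ω → Plane) (s g : ℕ → Ω → ℝ)
    (lam : ℝ) (A : Set Plane) (ω : Ω) :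
    outsideTerm L x s g lam A ω = {i | x i ω ∉ A}.indicator
      ({i | s i ω ∈ Ioc 0 lam}.indicator fun i => L ‖x i ω‖ * g i ω) := by
  rw [indicator_indicator, inter_comm]
  rfl

/-- The difference collects the terms with `x i ω ∈ A`. The marks may have either sign, so each term
is bounded through `|g i|`, and the bound is then enlarged from `A` to the closed ball. -/
theorem abs_tsum_outsideTerm_sub_le (hfL : ∀ i, 0 < s i ω → L ‖x i ω‖ = (f (x i ω)).toReal)
    {lam r : ℝ} {A : Set Plane} (hA : A ⊆ Metric.closedBall 0 r)
    (hsum : Summable ({i | s i ω ∈ Ioc 0 lam}.indicator fun i => L ‖x i ω‖ * g i ω))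
    (hr : markSum ((Metric.closedBall 0 r).indicator f) x s (fun i ω => ‖g i ω‖₊) 0 lam ω ≠ ∞) :
    |∑' i, ({i | s i ω ∈ Ioc 0 lam}.indicator fun i => L ‖x i ω‖ * g i ω) i -
        ∑' i, outsideTerm L x s g lam A ω i| ≤
      (markSum ((Metric.closedBall 0 r).indicator f) x s (fun i ω => ‖g i ω‖₊) 0 lam ω).toReal := by
  have ho := outsideTerm_eq_indicator L x s g lam A ω
  have hos : Summable (outsideTerm L x s g lam A ω) := by
    rw [ho]
    exact hsum.indicator _
  rw [← hsum.tsum_sub hos, ← Real.norm_eq_abs]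
  have h1 := ENNReal.hasSum_toReal hr
  rw [← ENNReal.tsum_toReal_eq (ENNReal.ne_top_of_tsum_ne_top hr)] at h1
  refine tsum_of_norm_bounded h1 fun i => ?_
  by_cases hi : i ∈ {i | s i ω ∈ Ioc 0 lam}
  · by_cases hA' : x i ω ∈ A
    · have hn : i ∉ {i | x i ω ∉ A} := fun h => h hA'
      rw [ho, indicator_of_notMem hn, sub_zero, indicator_of_mem hi, indicator_of_mem hi,
        indicator_of_mem (hA hA'), hfL i hi.1, ENNReal.toReal_mul, norm_mul,
        Real.norm_of_nonneg ENNReal.toReal_nonneg]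
      simp
    · have hm : i ∈ {i | x i ω ∉ A} := hA'
      rw [ho, indicator_of_mem hm, sub_self, norm_zero]
      exact ENNReal.toReal_nonneg
  · rw [ho, indicator_indicator, indicator_of_notMem hi, indicator_of_notMem fun h => hi h.2,
      sub_zero, norm_zero]
    exact ENNReal.toReal_nonneg

end Deterministic

/-! ### Null sets, and assembly of the limit -/

section Main

variable {Ω : Type*} [MeasurableSpace Ω] {P : Measure Ω} {x : ℕ → Ω → Plane} {s : ℕ → Ω → ℝ}

/-- A null set has intensity `0`, so almost surely no point added at a positive level hits it. This
allows `L ‖·‖`, which is only almost everywhere measurable, to be replaced by a measurable function.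
-/
theorem IsSuperposedHPPP.ae_forall_of_ae (hΦ : IsSuperposedHPPP x s P) {q : Plane → Prop}
    (hq : ∀ᵐ p, q p) : ∀ᵐ ω ∂P, ∀ i, 0 < s i ω → q (x i ω) := by
  obtain ⟨N, hN, hNm, hN0⟩ := exists_measurable_superset_of_null (ae_iff.1 hq)
  have hk : ∀ᵐ ω ∂P, ∀ k : ℕ, countIn x s 0 (k + 1) N ω = 0 := by
    refine ae_all_iff.2 fun k => ?_
    have hv := intensity_ne_top (B := N) (by simp [hN0]) ((k : ℝ) + 1 - 0)
    have hpp := hΦ.poisson 0 (k + 1) le_rfl (by positivity)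
    have h0 := hpp.lintegral_eq hNm hv
    have haem : AEMeasurable (fun ω => ((countIn x s 0 (k + 1) N ω : ℕ∞) : ℝ≥0∞)) P :=
      (measurable_of_countable (fun m : ℕ∞ => (m : ℝ≥0∞))).comp_aemeasurable
        (hpp.law N hNm hv).aemeasurable
    rw [Measure.smul_apply, hN0, smul_zero, lintegral_eq_zero_iff' haem] at h0
    filter_upwards [h0] with ω hω
    simpa using hω
  filter_upwards [hk] with ω hω i hi
  by_contra hcon
  obtain ⟨k, hk⟩ := exists_nat_ge (s i ω)
  have := encard_eq_zero.1 (hω k)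
  exact (eq_empty_iff_forall_notMem.1 this i) ⟨⟨hi, by linarith⟩, hN hcon⟩

variable [IsProbabilityMeasure P] {g : ℕ → Ω → ℝ}

/-- Equality in law makes the marks only almost everywhere measurable; they are exchanged for
measurable versions off one null set. The function `h` will be the positive part, the negative part,
the absolute value and the constant `1`. -/
theorem ae_tendsto_markSum_comp_div (hΦ : IsSuperposedHPPP x s P) (hgi : iIndepFun g P)
    (hgd : ∀ i, IdentDistrib (g i) (g 0) P P)
    (hgz : IndepFun (fun ω i => g i ω) (fun ω i => (x i ω, s i ω)) P)
    {h : ℝ → ℝ≥0} (hh : Measurable h) (hint : ∫⁻ ω, h (g 0 ω) ∂P ≠ ∞)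
    {f : Plane → ℝ≥0∞} (hf : Measurable f) (hfint : ∫⁻ p, f p ≠ ∞) :
    ∀ᵐ ω ∂P, (∀ lam, markSum f x s (fun i ω => h (g i ω)) 0 lam ω ≠ ∞) ∧
      Tendsto (fun lam => (markSum f x s (fun i ω => h (g i ω)) 0 lam ω).toReal / lam) atTop
        (𝓝 ((∫⁻ p, f p).toReal * (∫⁻ ω, h (g 0 ω) ∂P).toReal)) := by
  have ham : ∀ i, AEMeasurable (g i) P := fun i => (hgd i).aemeasurable_fst
  let γ : ℕ → Ω → ℝ := fun i => (ham i).mk (g i)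
  have hγ : ∀ i, Measurable (γ i) := fun i => (ham i).measurable_mk
  have hae : ∀ i, g i =ᵐ[P] γ i := fun i => (ham i).ae_eq_mk
  have hall : ∀ᵐ ω ∂P, ∀ i, g i ω = γ i ω := ae_all_iff.2 hae
  have hγi : iIndepFun γ P := hgi.congr hae
  have hγd : ∀ i, IdentDistrib (γ i) (γ 0) P P := fun i =>
    ((IdentDistrib.of_ae_eq (ham i) (hae i)).symm.trans (hgd i)).trans
      (IdentDistrib.of_ae_eq (ham 0) (hae 0))
  have hγz : IndepFun (fun ω i => γ i ω) (fun ω i => (x i ω, s i ω)) P :=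
    hgz.congr (hall.mono fun ω hω => funext hω) (ae_of_all _ fun _ => rfl)
  have hmean : ∫⁻ ω, h (γ 0 ω) ∂P = ∫⁻ ω, h (g 0 ω) ∂P :=
    lintegral_congr_ae ((hae 0).mono fun ω hω => by simp only [hω])
  have hmap : Measurable fun (c : ℕ → ℝ) i => h (c i) :=
    measurable_pi_lambda _ fun i => hh.comp (measurable_pi_apply i)
  have key := ae_tendsto_markSum_div (g := fun i ω => h (γ i ω)) hΦ (fun i => hh.comp (hγ i))
    (hγi.comp (fun _ => h) fun _ => hh) (fun i => (hγd i).comp hh) (hγz.comp hmap measurable_id)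
    (hmean ▸ hint) hf hfint
  filter_upwards [key, hall] with ω hω heq
  rw [hmean] at hω
  simpa only [markSum, heq] using hω

end Main

theorem lemma1 {Ω : Type*} [MeasurableSpace Ω] (P : Measure Ω) [IsProbabilityMeasure P]
    (L : ℝ → ℝ) (hL : PhysicallyFeasible L)
    (x : ℕ → Ω → Plane) (s : ℕ → Ω → ℝ) (hΦ : IsSuperposedHPPP x s P)
    (g : ℕ → Ω → ℝ) (hg_indep : iIndepFun g P) (hg_ident : ∀ i, IdentDistrib (g i) (g 0) P P)
    (hg_int : Integrable (g 0) P) (hg_mean : ∫ ω, g 0 ω ∂P = 1)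
    (hgΦ : IndepFun (fun ω i => g i ω) (fun ω i => (x i ω, s i ω)) P)
    (n : ℕ) :
    ∀ᵐ ω ∂P,
      ((∀ lam : ℝ, 0 < lam →
          Summable (outsideTerm L x s g lam (Metric.ball 0 (nthDist x s n lam ω)) ω)) ∧
        Tendsto (fun lam : ℝ => (1 / lam) *
            ∑' i, outsideTerm L x s g lam (Metric.ball 0 (nthDist x s n lam ω)) ω i)
          atTop (𝓝 (2 * Real.pi * pathGamma L))) ∧
      ((∀ lam : ℝ, 0 < lam →
          Summable (outsideTerm L x s g lam (Metric.closedBall 0 (nthDist x s n lam ω)) ω)) ∧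
        Tendsto (fun lam : ℝ => (1 / lam) *
            ∑' i, outsideTerm L x s g lam (Metric.closedBall 0 (nthDist x s n lam ω)) ω i)
          atTop (𝓝 (2 * Real.pi * pathGamma L))) := by
  have hLint := hL.integrable_norm
  set F : Plane → ℝ := hLint.1.mk _ with hF
  have hFm : Measurable F := hLint.1.stronglyMeasurable_mk.measurable
  have hLF : (fun p : Plane => L ‖p‖) =ᵐ[volume] F := hLint.1.ae_eq_mk
  set f : Plane → ℝ≥0∞ := fun p => ENNReal.ofReal (F p) with hf_def
  have hf : Measurable f := hFm.ennreal_ofReal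
  have hfL : ∀ᵐ p : Plane, L ‖p‖ = (f p).toReal := by
    filter_upwards [hLF] with p hp
    rw [hf_def]
    simp only
    rw [← hp, ENNReal.toReal_ofReal (hL.nonneg _ (norm_nonneg p))]
  have hf_eq : ∫⁻ p, f p = ENNReal.ofReal (2 * Real.pi * pathGamma L) := by
    rw [← PhysicallyFeasible.integral_norm, ofReal_integral_eq_lintegral_ofReal hLint
      (ae_of_all _ fun p => hL.nonneg _ (norm_nonneg p))]
    exact lintegral_congr_ae (hLF.mono fun p hp => by simp only [hf_def, ← hp])
  have hfint : ∫⁻ p, f p ≠ ∞ := hf_eq ▸ ENNReal.ofReal_ne_top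
  have hfint' : (∫⁻ p, f p).toReal = 2 * Real.pi * pathGamma L := by
    rw [hf_eq, ENNReal.toReal_ofReal]
    have := hL.gamma_pos
    positivity
  -- Countably many radii tending to `0`, so that a single null set serves for all of them.
  let r : ℕ → ℝ := fun m => 1 / ((m : ℝ) + 1)
  have hr : ∀ m, 0 < r m := fun m => by positivity
  let D : ℕ → Set Plane := fun m => Metric.closedBall 0 (r m)
  have hD : ∀ m, MeasurableSet (D m) := fun m => Metric.isClosed_closedBall.measurableSet
  have hfD : ∀ m, ∫⁻ p, (D m).indicator f p = ∫⁻ p in D m, f p := fun m =>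
    lintegral_indicator (hD m) f
  have hfDint : ∀ m, ∫⁻ p, (D m).indicator f p ≠ ∞ := fun m => by
    rw [hfD]
    exact ((setLIntegral_le_lintegral _ _).trans_lt hfint.lt_top).ne
  have hvolD : ∀ m, volume (D m) ≠ ∞ := fun m =>
    (isCompact_closedBall (0 : Plane) (r m)).measure_lt_top.ne
  have hsmall : Tendsto (fun m => (∫⁻ p, (D m).indicator f p).toReal) atTop (𝓝 0) := by
    have hv0 : Tendsto (volume ∘ D) atTop (𝓝 0) := by
      have h1 : Tendsto (fun m => ENNReal.ofReal (r m)) atTop (𝓝 0) := by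
        rw [← ENNReal.ofReal_zero]
        exact ENNReal.tendsto_ofReal tendsto_one_div_add_atTop_nhds_zero_nat
      have h2 := ENNReal.Tendsto.mul_const (b := ENNReal.ofReal Real.pi)
        (ENNReal.Tendsto.pow (n := 2) h1) (Or.inr ENNReal.ofReal_ne_top)
      rw [zero_pow two_ne_zero, zero_mul] at h2
      refine h2.congr fun m => ?_
      rw [Function.comp_apply, EuclideanSpace.volume_closedBall_fin_two]
    have h3 := (ENNReal.tendsto_toReal ENNReal.zero_ne_top).comp (tendsto_setLIntegral_zero hfint hv0)
    simp only [hfD]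
    exact h3
  have hnn : ∫⁻ ω, ‖g 0 ω‖₊ ∂P ≠ ∞ := hg_int.2.ne
  have hpos_le : ∫⁻ ω, (g 0 ω).toNNReal ∂P ≠ ∞ :=
    (hg_int.lintegral_lt_top).ne
  have hneg_le : ∫⁻ ω, (-g 0 ω).toNNReal ∂P ≠ ∞ :=
    (hg_int.neg.lintegral_lt_top).ne
  have hmean : (∫⁻ ω, (g 0 ω).toNNReal ∂P).toReal - (∫⁻ ω, (-g 0 ω).toNNReal ∂P).toReal = 1 := by
    rw [← hg_mean, integral_eq_lintegral_pos_part_sub_lintegral_neg_part hg_int]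
    rfl
  have hslln := fun {h : ℝ → ℝ≥0} (hh : Measurable h) hint {f : Plane → ℝ≥0∞} (hf : Measurable f)
    hfint => ae_tendsto_markSum_comp_div hΦ hg_indep hg_ident hgΦ (h := h) hh hint (f := f) hf hfint
  have hP := hslln measurable_real_toNNReal hpos_le hf hfint
  have hN := hslln (h := fun y => (-y).toNNReal) (measurable_real_toNNReal.comp measurable_neg)
    hneg_le hf hfint
  have hA := ae_all_iff.2 fun m => hslln measurable_nnnorm hnn (hf.indicator (hD m)) (hfDint m)
  have hO := ae_all_iff.2 fun m => hslln (h := fun _ => 1) measurable_const (by simp)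
    (f := (D m).indicator fun _ => 1) (measurable_const.indicator (hD m))
    (by simpa [lintegral_indicator (hD m)] using hvolD m)
  filter_upwards [hP, hN, hA, hO, hΦ.ae_forall_of_ae hfL] with ω hPω hNω hAω hOω hLω
  have hfull := fun lam => hasSum_fullSum hLω (hPω.1 lam) (hNω.1 lam)
  have hnear : ∀ m, ∀ᶠ lam in atTop, nthDist x s n lam ω ≤ r m := fun m => by
    refine eventually_nthDist_le ?_ (hOω m).2 n
    rw [lintegral_indicator_const (hD m)]
    have h1 : 0 < (volume (D m)).toReal :=
      ENNReal.toReal_pos (Metric.measure_closedBall_pos volume 0 (hr m)).ne' (hvolD m)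
    simpa using h1
  -- Only inclusion in the closed disk matters, which settles the open and the closed disk together.
  have main : ∀ A : ℝ → Set Plane,
      (∀ lam, A lam ⊆ Metric.closedBall 0 (nthDist x s n lam ω)) →
      (∀ lam : ℝ, 0 < lam → Summable (outsideTerm L x s g lam (A lam) ω)) ∧
        Tendsto (fun lam : ℝ => (1 / lam) * ∑' i, outsideTerm L x s g lam (A lam) ω i)
          atTop (𝓝 (2 * Real.pi * pathGamma L)) := by
    intro A hAsub
    refine ⟨fun lam _ => ?_, ?_⟩
    · rw [outsideTerm_eq_indicator]
      exact (hfull lam).summable.indicator _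
    · have hlim : Tendsto (fun lam : ℝ =>
          (∑' i, ({i | s i ω ∈ Ioc 0 lam}.indicator fun i => L ‖x i ω‖ * g i ω) i) / lam) atTop
          (𝓝 (2 * Real.pi * pathGamma L)) := by
        have := hPω.2.sub hNω.2
        rw [← mul_sub, hmean, mul_one, hfint'] at this
        refine this.congr fun lam => ?_
        rw [(hfull lam).tsum_eq, sub_div]
      rw [← sub_zero (2 * Real.pi * pathGamma L)]
      have hdiff : Tendsto (fun lam : ℝ =>
          ((∑' i, ({i | s i ω ∈ Ioc 0 lam}.indicator fun i => L ‖x i ω‖ * g i ω) i) -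
            ∑' i, outsideTerm L x s g lam (A lam) ω i) / lam) atTop (𝓝 0) := by
        rw [Metric.tendsto_nhds]
        intro δ hδ
        -- The radius is chosen first, with `E|g| ∫_{D m} f < δ`; then `lam` is taken large enough
        -- for the removed disk to lie in `D m` and for the strong law on `D m` to be within the
        -- bound.
        have h1 := hsmall.mul_const (∫⁻ ω, ‖g 0 ω‖₊ ∂P).toReal
        rw [zero_mul] at h1
        obtain ⟨m, hm⟩ := (h1.eventually_lt_const hδ).exists
        filter_upwards [hnear m, (hAω m).2.eventually_lt_const hm, eventually_gt_atTop 0] with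
          lam hR hlt hlam
        have hb := (abs_tsum_outsideTerm_sub_le hLω
          ((hAsub lam).trans (Metric.closedBall_subset_closedBall hR)) (hfull lam).summable
          ((hAω m).1 lam))
        rw [Real.dist_eq, sub_zero, abs_div, abs_of_pos hlam]
        exact (div_le_div_of_nonneg_right hb hlam.le).trans_lt hlt
      refine (hlim.sub hdiff).congr fun lam => ?_
      ring
  exact ⟨main (fun lam => Metric.ball 0 (nthDist x s n lam ω)) fun _ => Metric.ball_subset_closedBall,
    main (fun lam => Metric.closedBall 0 (nthDist x s n lam ω)) fun _ => subset_rfl⟩
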